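/- Let $n\ge 2$, $k\ge 1$, $\epsilon\in\{0,1\}$, $\tau=2k-1+\epsilon$. A finite set $C\subset\mathbb S^{n-1}$ is a spherical $\tau$-design if, for every real polynomial in $n$ variables of degree at most $\tau$, its average over $C$ equals its average over $\mathbb S^{n-1}$ with respect to surface measure. A sharp code of strength $\tau$ is a spherical $\tau$-design $C$ with at most $\lfloor(\tau+1)/2\rfloor$ distinct inner products between distinct points of $C$. It is strongly sharp if $\tau$ is even, and antipodal if $C=-C$. Let $d\mu_n(t)=\gamma_n(1-t^2)^{(n-3)/2}\,dt$ be normalized to a probability measure on $[-1,1]$, and let $P_m^{(a,b)}$ be the Jacobi polynomial of degree $m$ with parameters $a+\frac{n-3}{2},\,b+\frac{n-3}{2}$, that is, the orthogonal polynomial of degree $m$ on $[-1,1]$ for the weight $(1-t)^{a+(n-3)/2}(1+t)^{b+(n-3)/2}$, normalized by $P_m^{(a,b)}(1)=1$. Let $\alpha_0,\dots,\alpha_k$ be the distinct zeros of $(t-1)(t+1)^{1-\epsilon}P_{k-1+\epsilon}^{(1,1-\epsilon)}(t)$, let $\ell_i$ be the Lagrange basis polynomials of these nodes, and put $\rho_i=\int_{-1}^1\ell_i\,d\mu_n$.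 **Theorem.** Let $h:[-1,1]\to\mathbb R$ be continuous on $[-1,1]$ and $\tau+1$ times differentiable on $(-1,1)$ with $h^{(\tau+1)}\le 0$ there. Let $C\subset\mathbb S^{n-1}$ be a strongly sharp code or an antipodal sharp code of strength $\tau$, and let $U_h(x,C)=\sum_{y\in C}h(x\cdot y)$. Then $C$ is non-empty and the minimum of $U_h(\cdot,C)$ over $\mathbb S^{n-1}$ is attained at every point of $C$. Moreover, the polynomial above has exactly $k+1$ distinct zeros $\alpha_i$, all in $[-1,1]$, the weights $\rho_i$ are positive with $\sum_{i=0}^k\rho_i=1$, and $C$ attains the polarization universal lower bound: $$\inf_{x\in\mathbb S^{n-1}}U_h(x,C)=|C|\sum_{i=0}^k\rho_i\,h(\alpha_i).$$ -/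

import Mathlib

open MeasureTheory Polynomial

/-- The unit sphere of `ℝⁿ`. -/
abbrev USphere (n : ℕ) : Type := Metric.sphere (0 : EuclideanSpace ℝ (Fin n)) 1

/-- The Euclidean inner product `x · y` of two points of the unit sphere. -/
noncomputable def sdot {n : ℕ} (x y : USphere n) : ℝ :=
  inner ℝ (x : EuclideanSpace ℝ (Fin n)) (y : EuclideanSpace ℝ (Fin n))

/-- A finite set `C` of points of the unit sphere is a spherical `τ`-design: for every real
polynomial in `n` variables of degree at most `τ`, the average over `C` equals the average over
the sphere with respect to the surface measure. -/
def IsSphericalDesign {n : ℕ} (τ : ℕ) (C : Finset (USphere n)) : Prop :=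
  ∀ f : MvPolynomial (Fin n) ℝ, f.totalDegree ≤ τ →
    (⨍ x : USphere n, MvPolynomial.eval (fun i => (x : EuclideanSpace ℝ (Fin n)) i) f
        ∂((volume : Measure (EuclideanSpace ℝ (Fin n))).toSphere)) =
      (∑ x ∈ C, MvPolynomial.eval (fun i => (x : EuclideanSpace ℝ (Fin n)) i) f) / (C.card : ℝ)

/-- The set of inner products between distinct points of `C`. -/
def innerProducts {n : ℕ} (C : Finset (USphere n)) : Set ℝ :=
  {t | ∃ x ∈ C, ∃ y ∈ C, x ≠ y ∧ sdot x y = t}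

/-- A sharp code: a spherical `τ`-design with at most `⌊(τ + 1) / 2⌋` distinct inner products
between distinct points. -/
def IsSharp {n : ℕ} (τ : ℕ) (C : Finset (USphere n)) : Prop :=
  IsSphericalDesign τ C ∧ (innerProducts C).ncard ≤ (τ + 1) / 2

/-- A strongly sharp code: a sharp code of even strength. -/
def IsStronglySharp {n : ℕ} (τ : ℕ) (C : Finset (USphere n)) : Prop :=
  IsSharp τ C ∧ Even τ

/-- An antipodal sharp code: a sharp code with `C = -C`. -/
def IsAntipodalSharp {n : ℕ} (τ : ℕ) (C : Finset (USphere n)) : Prop :=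
  IsSharp τ C ∧ ∀ x ∈ C, -x ∈ C

/-- The discrete potential `U_h(x, C) = ∑_{y ∈ C} h(x · y)`. -/
noncomputable def discretePotential {n : ℕ} (h : ℝ → ℝ) (x : USphere n)
    (C : Finset (USphere n)) : ℝ :=
  ∑ y ∈ C, h (sdot x y)

/-- The polarization `Q_h(C) = inf_x U_h(x, C)`, the infimum over the unit sphere. -/
noncomputable def polarization {n : ℕ} (h : ℝ → ℝ) (C : Finset (USphere n)) : ℝ :=
  ⨅ x : USphere n, discretePotential h x C

/-- The mean of `f` with respect to the probability measure on `[-1, 1]` with density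
proportional to `(1 - t²)^((n - 3) / 2)`. -/
noncomputable def gegenbauerMean (n : ℕ) (f : ℝ → ℝ) : ℝ :=
  (∫ t in (-1 : ℝ)..1, f t * (1 - t ^ 2) ^ (((n : ℝ) - 3) / 2)) /
    ∫ t in (-1 : ℝ)..1, (1 - t ^ 2) ^ (((n : ℝ) - 3) / 2)

/-- The inner product of polynomials with the Jacobi weight `(1 - t)^α (1 + t)^β`. -/
noncomputable def jacobiInner (α β : ℝ) (p q : ℝ[X]) : ℝ :=
  ∫ t in (-1 : ℝ)..1, p.eval t * q.eval t * ((1 - t) ^ α * (1 + t) ^ β)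

/-- The monic polynomials orthogonal with respect to `jacobiInner α β`, obtained from
`1, X, X², …` by the Gram–Schmidt process. -/
noncomputable def monicJacobi (α β : ℝ) (m : ℕ) : ℝ[X] :=
  X ^ m - ∑ j : Fin m,
    C (jacobiInner α β (X ^ m) (monicJacobi α β j) /
        jacobiInner α β (monicJacobi α β j) (monicJacobi α β j)) * monicJacobi α β j
termination_by m
decreasing_by all_goals exact j.isLt

/-- The Jacobi polynomial of degree `m` with parameters `α, β`, normalized to take the value `1`
at `1`. -/
noncomputable def jacobi (α β : ℝ) (m : ℕ) : ℝ[X] :=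
  C ((monicJacobi α β m).eval 1)⁻¹ * monicJacobi α β m

/-- The adjacent Gegenbauer polynomial `P_m^{(a, b)}` in dimension `n`. -/
noncomputable def adjacentGegenbauer (n a b m : ℕ) : ℝ[X] :=
  jacobi ((a : ℝ) + ((n : ℝ) - 3) / 2) ((b : ℝ) + ((n : ℝ) - 3) / 2) m

/-- The polynomial `(t - 1) (t + 1)^(1 - ε) P_{k - 1 + ε}^{(1, 1 - ε)}(t)`, used for `1 ≤ k` and
`ε ∈ {0, 1}`. -/
noncomputable def pulbPolynomial (n k ε : ℕ) : ℝ[X] :=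
  (X - 1) * (X + 1) ^ (1 - ε) * adjacentGegenbauer n 1 (1 - ε) (k - 1 + ε)

/-- The nodes: the zeros of `pulbPolynomial n k ε`. -/
noncomputable def pulbNodes (n k ε : ℕ) : Finset ℝ :=
  (pulbPolynomial n k ε).roots.toFinset

/-- The weight of the node `a`: the Gegenbauer mean of the Lagrange basis polynomial that is `1`
at `a` and `0` at the other nodes. -/
noncomputable def pulbWeight (n k ε : ℕ) (a : ℝ) : ℝ :=
  gegenbauerMean n fun t => (Lagrange.basis (pulbNodes n k ε) id a).eval t

/-- The universal lower bound `N ∑ ρ_i h(α_i)` for non-positive derivatives. -/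
noncomputable def pulbBound (n N k ε : ℕ) (h : ℝ → ℝ) : ℝ :=
  (N : ℝ) * ∑ a ∈ pulbNodes n k ε, pulbWeight n k ε a * h a

/-! Let A be the set of inner products of the code, Z = {1} ∪ A and D = A ∩ (-1, 1). Interpolate h
on Z and h' on D by a polynomial p of degree at most τ. The Hermite error is h^(τ+1)(ξ)/(τ+1)! times
(t - 1)(t + 1)^(1-ε) times a square, a product of two non-positive factors, so p ≤ h on [-1, 1]
(`exists_hermite_le`). By the design property ∑ p(x · y) does not depend on x. It bounds the
potential from below everywhere and equals it at the points of C, whose inner products all lie in Z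
(`polarization_of_pulbNodes_eq`).

The nodes are identified through orthogonality. A polynomial of degree at most τ vanishing on Z has
Gegenbauer integral 0. Moving 1 - t, and also 1 + t when ε = 0, into the weight shows that the nodal
polynomial of the remaining inner products is orthogonal to all lower degrees, so it is the monic
Jacobi polynomial (`nodal_eq_monicJacobi`). Exactness on the Lagrange basis then makes each weight
the proportion of y in C with x · y equal to the node, which gives positivity and total mass 1.

The passage from surface measure to the interval is `average_eval_inner`: the moments of x · y and
those of the Gegenbauer weight obey the same recursion, the former by Gaussian integrals and the
latter by integration by parts. -/

/-! ### Rolle's theorem and Hermite interpolation from below -/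

/-- Rolle's theorem for finite sets of zeros: a function with `m + 1` zeros has a derivative with
at least `m` zeros, distinct from the given ones. -/
theorem exists_finset_zeros_deriv {f f' : ℝ → ℝ} {S I : Set ℝ} [S.OrdConnected]
    (hSI : ∀ x ∈ S, ∀ y ∈ S, Set.Ioo x y ⊆ I) (hc : ContinuousOn f S)
    (hd : ∀ t ∈ I, HasDerivAt f (f' t) t) (Z : Finset ℝ) (hZ : ∀ z ∈ Z, z ∈ S ∧ f z = 0) :
    ∃ Y : Finset ℝ, Z.card ≤ Y.card + 1 ∧ Disjoint Y Z ∧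
      ∀ y ∈ Y, y ∈ I ∧ f' y = 0 ∧ ∃ z ∈ Z, y < z := by
  classical
  induction Z using Finset.induction_on_max with
  | empty => exact ⟨∅, by simp⟩
  | insert m Z hm ih =>
    obtain ⟨Y, hcard, hdisj, hY⟩ := ih fun z hz => hZ z (Finset.mem_insert_of_mem hz)
    rcases Z.eq_empty_or_nonempty with rfl | hne
    · exact ⟨∅, by simp⟩
    have hM := Z.max'_mem hne
    obtain ⟨hMS, hM0⟩ := hZ _ (Finset.mem_insert_of_mem hM)
    obtain ⟨hmS, hm0⟩ := hZ m (Finset.mem_insert_self _ _)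
    obtain ⟨c, hc1, hc2⟩ := exists_hasDerivAt_eq_zero (f := f) (f' := f') (hm _ hM)
      (hc.mono (Set.OrdConnected.out ‹_› hMS hmS)) (hM0.trans hm0.symm)
      fun x hx => hd x (hSI _ hMS _ hmS hx)
    -- The clause `∃ z ∈ Z, y < z` is the induction invariant: old zeros lie below `Z.max'`, the new
    -- one above it.
    have hcY : c ∉ Y := fun h => by
      obtain ⟨z, hz, hlt⟩ := (hY c h).2.2
      exact absurd (Z.le_max' z hz) (not_le.mpr (hc1.1.trans hlt))
    refine ⟨insert c Y, ?_, ?_, ?_⟩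
    · rw [Finset.card_insert_of_notMem hcY,
        Finset.card_insert_of_notMem fun h => (hm m h).ne rfl]
      omega
    · rw [Finset.disjoint_left]
      intro y hy hy'
      rcases Finset.mem_insert.mp hy with rfl | hy
      · rcases Finset.mem_insert.mp hy' with h | h
        · exact hc1.2.ne h
        · exact absurd (Z.le_max' _ h) (not_le.mpr hc1.1)
      · rcases Finset.mem_insert.mp hy' with rfl | h
        · obtain ⟨z, hz, hlt⟩ := (hY y hy).2.2
          exact (hlt.trans (hm z hz)).ne rfl
        · exact Finset.disjoint_left.mp hdisj hy h
    · intro y hy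
      rcases Finset.mem_insert.mp hy with rfl | hy
      · exact ⟨hSI _ hMS _ hmS hc1, hc2, m, Finset.mem_insert_self _ _, hc1.2⟩
      · obtain ⟨h1, h2, z, hz, hlt⟩ := hY y hy
        exact ⟨h1, h2, z, Finset.mem_insert_of_mem hz, hlt⟩

/-- Iterated Rolle theorem on an open interval. -/
theorem exists_zero_of_card_zeros {a b : ℝ} (N : ℕ) (F : ℕ → ℝ → ℝ)
    (hF : ∀ i < N, ∀ t ∈ Set.Ioo a b, HasDerivAt (F i) (F (i + 1) t) t) (Z : Finset ℝ)
    (hZ : ∀ z ∈ Z, z ∈ Set.Ioo a b ∧ F 0 z = 0) (hcard : N + 1 ≤ Z.card) :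
    ∃ t ∈ Set.Ioo a b, F N t = 0 := by
  induction N generalizing F Z with
  | zero =>
    obtain ⟨z, hz⟩ := Finset.card_pos.mp (by omega : 0 < Z.card)
    exact ⟨z, hZ z hz⟩
  | succ N ih =>
    obtain ⟨Y, h1, -, h3⟩ := exists_finset_zeros_deriv (f := F 0) (f' := F 1)
      (S := Set.Ioo a b) (I := Set.Ioo a b)
      (fun x hx y hy t ht => ⟨hx.1.trans ht.1, ht.2.trans hy.2⟩)
      (fun t ht => (hF 0 (by omega) t ht).continuousAt.continuousWithinAt)
      (hF 0 (by omega)) Z hZ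
    exact ih (fun i => F (i + 1)) (fun i hi => hF (i + 1) (by omega)) Y
      (fun y hy => ⟨(h3 y hy).1, (h3 y hy).2.1⟩) (by omega)

/-- Existence of Hermite interpolation polynomials: values on `Z`, derivatives on `D ⊆ Z`. -/
theorem exists_hermite_interpolation (Z D : Finset ℝ) (hDZ : D ⊆ Z) (hZ : Z.Nonempty)
    (u v : ℝ → ℝ) :
    ∃ p : ℝ[X], p.natDegree < Z.card + D.card ∧ (∀ z ∈ Z, p.eval z = u z) ∧
      ∀ d ∈ D, (derivative p).eval d = v d := by
  classical
  set L := Lagrange.interpolate Z id u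
  set W : ℝ[X] := Lagrange.nodal Z id
  -- Adding `W * q` keeps the values on `Z` and changes the derivative at `d` by `W'(d) q(d)`, where
  -- `W'(d) ≠ 0` because the zeros of `W` are simple.
  set q := Lagrange.interpolate D id fun d =>
    (v d - (derivative L).eval d) / (derivative W).eval d
  have hW : ∀ d ∈ D, (derivative W).eval d ≠ 0 := by
    intro d hd h
    have := Lagrange.nodalWeight_ne_zero (s := Z) (v := id) (Set.injOn_id _) (hDZ hd)
    rw [Lagrange.nodalWeight_eq_eval_derivative_nodal (hDZ hd)] at this
    exact this (by simpa [W] using h)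
  have hcZ := Finset.card_pos.mpr hZ
  refine ⟨L + W * q, ?_, fun z hz => ?_, fun d hd => ?_⟩
  · have h1 : L.natDegree < Z.card + D.card := by
      rcases eq_or_ne L 0 with h | h
      · rw [h, natDegree_zero]; omega
      · have := (natDegree_lt_iff_degree_lt h).mpr
          (Lagrange.degree_interpolate_lt u (s := Z) (v := id) (Set.injOn_id _))
        omega
    have h2 : (W * q).natDegree < Z.card + D.card := by
      rcases eq_or_ne q 0 with h | h
      · rw [h, mul_zero, natDegree_zero]; omega
      · have := (natDegree_lt_iff_degree_lt h).mpr
          (Lagrange.degree_interpolate_lt _ (s := D) (v := id) (Set.injOn_id _))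
        have h3 : W.natDegree = Z.card := Lagrange.natDegree_nodal
        have := natDegree_mul_le (p := W) (q := q)
        omega
    exact (natDegree_add_le _ _).trans_lt (max_lt h1 h2)
  · have h1 : W.eval z = 0 := Lagrange.eval_nodal_at_node (v := id) hz
    have h2 : L.eval z = u z := Lagrange.eval_interpolate_at_node (v := id) u (Set.injOn_id _) hz
    simp [h1, h2]
  · have h1 : W.eval d = 0 := Lagrange.eval_nodal_at_node (v := id) (hDZ hd)
    have h2 : q.eval d = (v d - (derivative L).eval d) / (derivative W).eval d :=
      Lagrange.eval_interpolate_at_node (v := id) _ (Set.injOn_id _) hd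
    have h3 := hW d hd
    simp only [derivative_add, derivative_mul, eval_add, eval_mul, h1, h2]
    field_simp
    ring

theorem iterate_derivative_of_monic {W : ℝ[X]} (hW : W.Monic) {N : ℕ} (hN : W.natDegree = N)
    (t : ℝ) : (derivative^[N] W).eval t = N.factorial := by
  have h0 : (derivative^[N] W).natDegree ≤ 0 := by
    simpa [hN] using natDegree_iterate_derivative W N
  rw [eq_C_of_natDegree_le_zero h0, eval_C, coeff_iterate_derivative]
  simp [← hN, hW.coeff_natDegree, Nat.descFactorial_self]

/-- A function whose `N`-th derivative is non-positive lies above its Hermite interpolation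
polynomial wherever the nodal polynomial is non-positive. -/
theorem exists_hermite_le {a b : ℝ} (Z D : Finset ℝ) (hDZ : D ⊆ Z) (hZne : Z.Nonempty)
    (hZ : ∀ z ∈ Z, z ∈ Set.Icc a b) (hD : ∀ d ∈ D, d ∈ Set.Ioo a b) (H : ℕ → ℝ → ℝ)
    (hc : ContinuousOn (H 0) (Set.Icc a b))
    (hd : ∀ i < Z.card + D.card, ∀ t ∈ Set.Ioo a b, HasDerivAt (H i) (H (i + 1) t) t)
    (hneg : ∀ t ∈ Set.Ioo a b, H (Z.card + D.card) t ≤ 0)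
    (hsign : ∀ t ∈ Set.Icc a b, (∏ z ∈ Z, (t - z)) * ∏ d ∈ D, (t - d) ≤ 0) :
    ∃ p : ℝ[X], p.natDegree < Z.card + D.card ∧ (∀ z ∈ Z, p.eval z = H 0 z) ∧
      ∀ t ∈ Set.Icc a b, p.eval t ≤ H 0 t := by
  classical
  obtain ⟨p, hpdeg, hpZ, hpD⟩ := exists_hermite_interpolation Z D hDZ hZne (H 0) (H 1)
  refine ⟨p, hpdeg, hpZ, fun t ht => ?_⟩
  by_cases htZ : t ∈ Z
  · exact (hpZ t htZ).le
  set W : ℝ[X] := Lagrange.nodal Z id * Lagrange.nodal D id with hWdef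
  have hWm : W.Monic := (Lagrange.nodal_monic).mul Lagrange.nodal_monic
  have hWdeg : W.natDegree = Z.card + D.card := by
    rw [hWdef, (Lagrange.nodal_monic).natDegree_mul Lagrange.nodal_monic,
      Lagrange.natDegree_nodal, Lagrange.natDegree_nodal]
  have hWev : ∀ s, W.eval s = (∏ z ∈ Z, (s - z)) * ∏ d ∈ D, (s - d) := fun s => by
    simp [hWdef, Lagrange.eval_nodal]
  have hWt : W.eval t ≠ 0 := by
    rw [hWev]
    exact mul_ne_zero
      (Finset.prod_ne_zero_iff.mpr fun z hz => sub_ne_zero.mpr fun h => htZ (h ▸ hz))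
      (Finset.prod_ne_zero_iff.mpr fun z hz => sub_ne_zero.mpr fun h => htZ (h ▸ hDZ hz))
  have hWZ : ∀ z ∈ Z, W.eval z = 0 := fun z hz => by
    rw [hWev, Finset.prod_eq_zero hz (sub_self z), zero_mul]
  have hWD : ∀ d ∈ D, (derivative W).eval d = 0 := fun d hd => by
    have h1 : (Lagrange.nodal Z id).eval d = 0 := Lagrange.eval_nodal_at_node (v := id) (hDZ hd)
    have h2 : (Lagrange.nodal D id).eval d = 0 := Lagrange.eval_nodal_at_node (v := id) hd
    simp [hWdef, h1, h2]
  -- `K` is chosen so that `H 0 - p - K W` vanishes at `t` as well as on `Z`.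
  set K := (H 0 t - p.eval t) / W.eval t with hK
  have hKW : K * W.eval t = H 0 t - p.eval t := div_mul_cancel₀ _ hWt
  set G : ℝ[X] := p + Polynomial.C K * W with hG
  set F : ℕ → ℝ → ℝ := fun i s => H i s - (derivative^[i] G).eval s with hFdef
  have hF : ∀ i < Z.card + D.card, ∀ s ∈ Set.Ioo a b, HasDerivAt (F i) (F (i + 1) s) s := by
    intro i hi s hs
    simp only [hFdef, Function.iterate_succ_apply']
    exact (hd i hi s hs).sub (Polynomial.hasDerivAt _ s)
  have hcZ := Finset.card_pos.mpr hZne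
  -- The first Rolle step is separate: `H 0` is only continuous at the endpoints, and the new zeros
  -- avoid `Z`, so the double nodes `D` can be added to them.
  obtain ⟨Y, hYc, hYdisj, hY⟩ := exists_finset_zeros_deriv (f := F 0) (f' := F 1)
    (S := Set.Icc a b) (I := Set.Ioo a b)
    (fun x hx y hy s hs => ⟨hx.1.trans_lt hs.1, hs.2.trans_le hy.2⟩)
    (hc.sub (Polynomial.continuous _).continuousOn) (hF 0 (by omega)) (insert t Z) (by
      intro z hz
      rcases Finset.mem_insert.mp hz with rfl | hz
      · refine ⟨ht, ?_⟩
        simp only [hFdef, Function.iterate_zero, id, hG, eval_add, eval_mul, eval_C, hKW]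
        ring
      · refine ⟨hZ z hz, ?_⟩
        simp [hFdef, hG, hWZ z hz, hpZ z hz])
  rw [Finset.card_insert_of_notMem htZ] at hYc
  have hYD : Disjoint Y D := by
    rw [Finset.disjoint_left] at hYdisj ⊢
    exact fun y hy hyD => hYdisj hy (Finset.mem_insert_of_mem (hDZ hyD))
  obtain ⟨ξ, hξ, hξ0⟩ := exists_zero_of_card_zeros (a := a) (b := b) (Z.card + D.card - 1)
    (fun i => F (i + 1)) (fun i hi => hF (i + 1) (by omega)) (Y ∪ D) (by
      intro y hy
      rcases Finset.mem_union.mp hy with hy | hy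
      · exact ⟨(hY y hy).1, (hY y hy).2.1⟩
      · refine ⟨hD y hy, ?_⟩
        simp [hFdef, hG, hWD y hy, hpD y hy]) (by
      rw [Finset.card_union_of_disjoint hYD]; omega)
  have hN : Z.card + D.card - 1 + 1 = Z.card + D.card := by omega
  -- With `N = Z.card + D.card` this becomes `H N ξ = K * N!`, which fixes the sign of `K`.
  simp only [hN, hFdef, hG, iterate_map_add, iterate_derivative_C_mul, eval_add, eval_mul,
    eval_C, iterate_derivative_eq_zero hpdeg, iterate_derivative_of_monic hWm hWdeg,
    eval_zero, zero_add] at hξ0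
  have hKle : K ≤ 0 := by
    have h1 := hneg ξ hξ
    have h2 : (0 : ℝ) < (Z.card + D.card).factorial := by positivity
    by_contra hlt
    have := mul_pos (not_le.mp hlt) h2
    linarith
  have := mul_nonneg_of_nonpos_of_nonpos hKle ((hWev t).trans_le (hsign t ht))
  linarith

/-! ### Moments of linear forms on the sphere, via Gaussian integrals -/

/-- The radial Gaussian moment `∫₀^∞ r^p e^{-r²} dr`. -/
noncomputable def radialMoment (p : ℕ) : ℝ := ∫ r in Set.Ioi (0 : ℝ), r ^ p * Real.exp (-r ^ 2)

theorem radialMoment_eq_Gamma (p : ℕ) : radialMoment p = 1 / 2 * Real.Gamma (((p : ℝ) + 1) / 2) := by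
  have := integral_rpow_mul_exp_neg_rpow (p := 2) (q := p) (by norm_num)
    (by have : (0 : ℝ) ≤ p := p.cast_nonneg
        linarith)
  simpa [radialMoment] using this

theorem radialMoment_pos (p : ℕ) : 0 < radialMoment p := by
  rw [radialMoment_eq_Gamma]
  have := Real.Gamma_pos_of_pos (s := ((p : ℝ) + 1) / 2) (by positivity)
  positivity

theorem radialMoment_add_two (p : ℕ) : radialMoment (p + 2) = (p + 1) / 2 * radialMoment p := by
  rw [radialMoment_eq_Gamma, radialMoment_eq_Gamma,
    show (((p + 2 : ℕ) : ℝ) + 1) / 2 = ((p : ℝ) + 1) / 2 + 1 by push_cast; ring,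
    Real.Gamma_add_one (by positivity)]
  ring

section

variable {E : Type*} [NormedAddCommGroup E] [InnerProductSpace ℝ E] [FiniteDimensional ℝ E]
  [MeasurableSpace E] [BorelSpace E]

/-- The Gaussian moment of the linear form `⟪x, ·⟫`. -/
noncomputable def gaussianMoment (x : E) (m : ℕ) : ℝ :=
  ∫ v : E, inner ℝ x v ^ m * Real.exp (-‖v‖ ^ 2)

/-- The moment of the linear form `⟪x, ·⟫` on the unit sphere. -/
noncomputable def sphereMoment (x : E) (m : ℕ) : ℝ :=
  ∫ y : Metric.sphere (0 : E) 1, inner ℝ x (y : E) ^ m ∂((volume : Measure E).toSphere)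

theorem integrable_inner_pow_mul_exp [Nontrivial E] (x : E) (m : ℕ) :
    Integrable fun v : E => inner ℝ x v ^ m * Real.exp (-‖v‖ ^ 2) := by
  have h1 : Integrable fun v : E => ‖v‖ ^ m * Real.exp (-‖v‖ ^ 2) := by
    refine (integrable_fun_norm_addHaar (volume : Measure E)
      (f := fun r => r ^ m * Real.exp (-r ^ 2))).mpr ?_
    have := integrableOn_rpow_mul_exp_neg_mul_sq (b := 1) one_pos
      (s := ((Module.finrank ℝ E - 1 + m : ℕ) : ℝ))
      (lt_of_lt_of_le (by norm_num) (Nat.cast_nonneg _))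
    refine this.congr_fun (fun r _ => ?_) measurableSet_Ioi
    simp only [Real.rpow_natCast, pow_add, smul_eq_mul]
    ring_nf
  refine (h1.const_mul (‖x‖ ^ m)).mono' (by fun_prop) (.of_forall fun v => ?_)
  rw [norm_mul, norm_pow, Real.norm_of_nonneg (Real.exp_pos _).le, ← mul_assoc, ← mul_pow]
  gcongr
  exact norm_inner_le_norm x v

/-- Integration by parts in the direction `x`, where the derivative of `exp (-‖v‖²)` is `-2⟪x, v⟫
exp (-‖v‖²)`. For `m = 0` the truncated exponent `m - 1` is harmless, since the factor `m` vanishes.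
-/
theorem gaussianMoment_succ [Nontrivial E] {x : E} (hx : ‖x‖ = 1) (m : ℕ) :
    2 * gaussianMoment x (m + 1) = m * gaussianMoment x (m - 1) := by
  have hf : ∀ v : E, HasFDerivAt (fun v : E => inner ℝ x v ^ m)
      ((m * inner ℝ x v ^ (m - 1)) • innerSL ℝ x) v := fun v => by
    have := ((innerSL ℝ x).hasFDerivAt (x := v)).pow m
    simpa using this
  have hg : ∀ v : E, HasFDerivAt (fun v : E => Real.exp (-‖v‖ ^ 2))
      (Real.exp (-‖v‖ ^ 2) • (-((2 : ℝ) • innerSL ℝ v))) v := fun v => by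
    have := ((hasStrictFDerivAt_norm_sq v).hasFDerivAt.neg).exp
    rw [← Nat.cast_smul_eq_nsmul ℝ 2 (innerSL ℝ v)] at this
    exact this
  have hxx : inner ℝ x x = (1 : ℝ) := by rw [real_inner_self_eq_norm_sq, hx, one_pow]
  have key := integral_bilinear_hasFDerivAt_right_eq_neg_left_of_integrable
    (μ := (volume : Measure E)) (v := x) (B := ContinuousLinearMap.mul ℝ ℝ)
    (f := fun v : E => inner ℝ x v ^ m) (g := fun v : E => Real.exp (-‖v‖ ^ 2))
    (f' := fun v => (m * inner ℝ x v ^ (m - 1)) • innerSL ℝ x)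
    (g' := fun v => Real.exp (-‖v‖ ^ 2) • (-((2 : ℝ) • innerSL ℝ v)))
    (((integrable_inner_pow_mul_exp x (m - 1)).const_mul (m : ℝ)).congr
      (.of_forall fun v => by simp [hx]; ring))
    (((integrable_inner_pow_mul_exp x (m + 1)).const_mul (-2 : ℝ)).congr
      (.of_forall fun v => by simp [real_inner_comm]; ring))
    (integrable_inner_pow_mul_exp x m) (fun v _ => hf v) (fun v _ => hg v)
  have h1 : ∫ v : E, (ContinuousLinearMap.mul ℝ ℝ (inner ℝ x v ^ m))
      ((Real.exp (-‖v‖ ^ 2) • (-((2 : ℝ) • innerSL ℝ v))) x) = -2 * gaussianMoment x (m + 1) := by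
    rw [gaussianMoment, ← integral_const_mul]
    refine integral_congr_ae (.of_forall fun v => ?_)
    simp [real_inner_comm]
    ring
  have h2 : ∫ v : E, (ContinuousLinearMap.mul ℝ ℝ
      (((m * inner ℝ x v ^ (m - 1)) • innerSL ℝ x) x)) (Real.exp (-‖v‖ ^ 2)) =
      m * gaussianMoment x (m - 1) := by
    rw [gaussianMoment, ← integral_const_mul]
    refine integral_congr_ae (.of_forall fun v => ?_)
    simp [hx]
    ring
  rw [h1, h2] at key
  linarith

/-- Polar coordinates: the integrand is a product in `v = r y`, and the radial measure contributes
`r^(d - 1)`. -/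
theorem gaussianMoment_eq_sphereMoment_mul [Nontrivial E] (x : E) (m : ℕ) :
    gaussianMoment x m = sphereMoment x m * radialMoment (Module.finrank ℝ E - 1 + m) := by
  set d := Module.finrank ℝ E
  have h1 : gaussianMoment x m = ∫ v : ({0}ᶜ : Set E), inner ℝ x (v : E) ^ m *
      Real.exp (-‖(v : E)‖ ^ 2) ∂((volume : Measure E).comap (↑)) := by
    rw [integral_subtype_comap (measurableSet_singleton _).compl
      fun v : E => inner ℝ x v ^ m * Real.exp (-‖v‖ ^ 2), restrict_compl_singleton]
    rfl
  have h2 := (volume : Measure E).measurePreserving_homeomorphUnitSphereProd.integral_comp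
    (Homeomorph.measurableEmbedding _)
    (fun p : Metric.sphere (0 : E) 1 × Set.Ioi (0 : ℝ) =>
      inner ℝ x (p.1 : E) ^ m * ((p.2 : ℝ) ^ m * Real.exp (-(p.2 : ℝ) ^ 2)))
  have h3 : ∫ r : Set.Ioi (0 : ℝ), (r : ℝ) ^ m * Real.exp (-(r : ℝ) ^ 2)
      ∂(Measure.volumeIoiPow (d - 1)) = radialMoment (d - 1 + m) := by
    simp only [Measure.volumeIoiPow, ENNReal.ofReal]
    rw [integral_withDensity_eq_integral_smul (by fun_prop),
      integral_subtype_comap measurableSet_Ioi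
        fun a : ℝ => Real.toNNReal (a ^ (d - 1)) • (a ^ m * Real.exp (-a ^ 2)), radialMoment]
    refine setIntegral_congr_fun measurableSet_Ioi fun r hr => ?_
    simp only [NNReal.smul_def, Real.coe_toNNReal _ (pow_nonneg (le_of_lt hr) _), pow_add,
      smul_eq_mul, mul_assoc]
  rw [h1, ← h3, sphereMoment, ← integral_prod_mul, ← h2]
  refine integral_congr_ae (.of_forall fun v => ?_)
  have hv : ‖(v : E)‖ ≠ 0 := norm_ne_zero_iff.mpr v.2
  simp only [homeomorphUnitSphereProd_apply_fst_coe, homeomorphUnitSphereProd_apply_snd_coe,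
    inner_smul_right]
  rw [← mul_assoc, ← mul_pow]
  field_simp

theorem sphereMoment_one [Nontrivial E] {x : E} (hx : ‖x‖ = 1) : sphereMoment x 1 = 0 := by
  have h := gaussianMoment_succ hx 0
  rw [gaussianMoment_eq_sphereMoment_mul] at h
  simpa [(radialMoment_pos _).ne'] using h

/-- The Gaussian recursion divided by the radial one; the radial factor `(d - 1 + m + 1) / 2`
produces `d + m`. -/
theorem sphereMoment_add_two [Nontrivial E] {x : E} (hx : ‖x‖ = 1) (m : ℕ) :
    (Module.finrank ℝ E + m) * sphereMoment x (m + 2) = (m + 1) * sphereMoment x m := by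
  have h := gaussianMoment_succ hx (m + 1)
  have hd : 0 < Module.finrank ℝ E := Module.finrank_pos
  rw [gaussianMoment_eq_sphereMoment_mul, gaussianMoment_eq_sphereMoment_mul,
    show Module.finrank ℝ E - 1 + (m + 1 + 1) = Module.finrank ℝ E - 1 + m + 2 by ring,
    radialMoment_add_two, Nat.add_sub_cancel] at h
  have hR := radialMoment_pos (Module.finrank ℝ E - 1 + m)
  push_cast [Nat.cast_pred hd] at h
  refine mul_right_cancel₀ hR.ne' ?_
  linear_combination h

end

/-! ### Jacobi functionals and their orthogonal polynomials -/

/-- The integral of a polynomial against the Jacobi weight `(1 - t)^α (1 + t)^β`. -/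
noncomputable def jacobiIntegral (α β : ℝ) (p : ℝ[X]) : ℝ :=
  ∫ t in Set.Ioo (-1 : ℝ) 1, p.eval t * ((1 - t) ^ α * (1 + t) ^ β)

theorem jacobiInner_eq (α β : ℝ) (p q : ℝ[X]) : jacobiInner α β p q = jacobiIntegral α β (p * q) := by
  rw [jacobiInner, jacobiIntegral, intervalIntegral.integral_of_le (by norm_num),
    integral_Ioc_eq_integral_Ioo]
  simp only [eval_mul]

/-- Splitting at 0 leaves one possibly singular factor on each half. -/
theorem integrableOn_jacobiWeight {α β : ℝ} (hα : -1 < α) (hβ : -1 < β) :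
    IntegrableOn (fun t : ℝ => (1 - t) ^ α * (1 + t) ^ β) (Set.Ioo (-1) 1) := by
  have h1 : IntervalIntegrable (fun t : ℝ => (1 - t) ^ α * (1 + t) ^ β) volume (-1) 0 := by
    have h : IntervalIntegrable (fun t : ℝ => (1 + t) ^ β) volume (-1) 0 := by
      have := (intervalIntegral.intervalIntegrable_rpow' (a := 0) (b := 1) hβ).comp_add_left 1
      simpa using this
    refine h.continuousOn_mul (ContinuousOn.rpow_const (by fun_prop) fun t ht => Or.inl ?_)
    rw [Set.uIcc_of_le (by norm_num)] at ht
    linarith [ht.2]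
  have h2 : IntervalIntegrable (fun t : ℝ => (1 - t) ^ α * (1 + t) ^ β) volume 0 1 := by
    have h : IntervalIntegrable (fun t : ℝ => (1 - t) ^ α) volume 0 1 := by
      have := (intervalIntegral.intervalIntegrable_rpow' (a := 1) (b := 0) hα).comp_sub_left 1
      simpa using this
    refine h.mul_continuousOn (ContinuousOn.rpow_const (by fun_prop) fun t ht => Or.inl ?_)
    rw [Set.uIcc_of_le (by norm_num)] at ht
    linarith [ht.1]
  have := h1.trans h2
  rwa [intervalIntegrable_iff_integrableOn_Ioo_of_le (by norm_num)] at this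

theorem integrableOn_eval_mul_jacobiWeight {α β : ℝ} (hα : -1 < α) (hβ : -1 < β) (p : ℝ[X]) :
    IntegrableOn (fun t : ℝ => p.eval t * ((1 - t) ^ α * (1 + t) ^ β)) (Set.Ioo (-1) 1) := by
  have h := integrableOn_jacobiWeight hα hβ
  rw [← intervalIntegrable_iff_integrableOn_Ioo_of_le (by norm_num)] at h ⊢
  exact h.continuousOn_mul p.continuous.continuousOn

theorem jacobiIntegral_add {α β : ℝ} (hα : -1 < α) (hβ : -1 < β) (p q : ℝ[X]) :
    jacobiIntegral α β (p + q) = jacobiIntegral α β p + jacobiIntegral α β q := by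
  rw [jacobiIntegral, jacobiIntegral, jacobiIntegral,
    ← integral_add (integrableOn_eval_mul_jacobiWeight hα hβ p)
      (integrableOn_eval_mul_jacobiWeight hα hβ q)]
  simp only [eval_add, add_mul]

theorem jacobiIntegral_C_mul (α β c : ℝ) (p : ℝ[X]) :
    jacobiIntegral α β (C c * p) = c * jacobiIntegral α β p := by
  rw [jacobiIntegral, jacobiIntegral, ← integral_const_mul]
  simp only [eval_mul, eval_C, mul_assoc]

/-- `jacobiIntegral` as a linear map. -/
noncomputable def jacobiFunctional {α β : ℝ} (hα : -1 < α) (hβ : -1 < β) : ℝ[X] →ₗ[ℝ] ℝ where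
  toFun := jacobiIntegral α β
  map_add' := jacobiIntegral_add hα hβ
  map_smul' c p := by rw [smul_eq_C_mul, jacobiIntegral_C_mul]; rfl

theorem jacobiFunctional_apply {α β : ℝ} (hα : -1 < α) (hβ : -1 < β) (p : ℝ[X]) :
    jacobiFunctional hα hβ p = jacobiIntegral α β p := rfl

/-- The weight is positive and the roots of `p` form a null set. This positivity drives the later
contradictions. -/
theorem jacobiIntegral_sq_pos {α β : ℝ} (hα : -1 < α) (hβ : -1 < β) {p : ℝ[X]} (hp : p ≠ 0) :
    0 < jacobiIntegral α β (p * p) := by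
  have hw : ∀ t ∈ Set.Ioo (-1 : ℝ) 1, (0 : ℝ) < (1 - t) ^ α * (1 + t) ^ β := fun t ht =>
    mul_pos (Real.rpow_pos_of_pos (by linarith [ht.2]) _)
      (Real.rpow_pos_of_pos (by linarith [ht.1]) _)
  rw [jacobiIntegral, setIntegral_pos_iff_support_of_nonneg_ae]
  · have h0 : (0 : ENNReal) < volume (Set.Ioo (-1 : ℝ) 1 \ (p.roots.toFinset : Set ℝ)) := by
      rw [measure_sdiff_null (p.roots.toFinset.finite_toSet.measure_zero _)]
      simp
    refine h0.trans_le (measure_mono fun t ht => ⟨?_, ht.1⟩)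
    have h1 : p.eval t ≠ 0 := fun h => ht.2 (by simp [hp, h])
    simp only [Function.mem_support, eval_mul]
    exact mul_ne_zero (mul_ne_zero h1 h1) (hw t ht.1).ne'
  · filter_upwards [ae_restrict_mem measurableSet_Ioo] with t ht
    simp only [eval_mul]
    exact mul_nonneg (mul_self_nonneg _) (hw t ht).le
  · exact integrableOn_eval_mul_jacobiWeight hα hβ _

/-- Used to pass linear factors between polynomial and weight. On the open interval the base is
nonzero, as splitting off one power requires. -/
theorem jacobiIntegral_add_one_left (α β : ℝ) (p : ℝ[X]) :
    jacobiIntegral (α + 1) β p = jacobiIntegral α β ((1 - X) * p) := by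
  refine setIntegral_congr_fun measurableSet_Ioo fun t ht => ?_
  have : (1 - t : ℝ) ≠ 0 := by linarith [ht.2]
  simp only [Real.rpow_add_one this, eval_mul, eval_sub, eval_one, eval_X]
  ring

theorem jacobiIntegral_add_one_right (α β : ℝ) (p : ℝ[X]) :
    jacobiIntegral α (β + 1) p = jacobiIntegral α β ((1 + X) * p) := by
  refine setIntegral_congr_fun measurableSet_Ioo fun t ht => ?_
  have : (1 + t : ℝ) ≠ 0 := by linarith [ht.1]
  simp only [Real.rpow_add_one this, eval_mul, eval_add, eval_one, eval_X]
  ring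

theorem monicJacobi_eq (α β : ℝ) (m : ℕ) : monicJacobi α β m =
    X ^ m - ∑ j : Fin m, C (jacobiInner α β (X ^ m) (monicJacobi α β j) /
      jacobiInner α β (monicJacobi α β j) (monicJacobi α β j)) * monicJacobi α β j := by
  rw [monicJacobi]

theorem monicJacobi_monic_natDegree (α β : ℝ) (m : ℕ) :
    (monicJacobi α β m).Monic ∧ (monicJacobi α β m).natDegree = m := by
  induction m using Nat.strong_induction_on with
  | _ m ih =>
    rw [monicJacobi_eq]
    set S := ∑ j : Fin m, C (jacobiInner α β (X ^ m) (monicJacobi α β j) /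
      jacobiInner α β (monicJacobi α β j) (monicJacobi α β j)) * monicJacobi α β j
    have hS : S.degree < (m : WithBot ℕ) := by
      refine (degree_sum_le _ _).trans_lt ((Finset.sup_lt_iff (WithBot.bot_lt_coe m)).mpr ?_)
      intro j _
      refine degree_le_natDegree.trans_lt ?_
      have h := (natDegree_C_mul_le (jacobiInner α β (X ^ m) (monicJacobi α β j) /
        jacobiInner α β (monicJacobi α β j) (monicJacobi α β j)) (monicJacobi α β j))
      rw [(ih j j.2).2] at h
      exact WithBot.coe_lt_coe.mpr (h.trans_lt j.2)
    have hS' : S.degree < (X ^ m : ℝ[X]).degree := by rwa [degree_X_pow]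
    refine ⟨(monic_X_pow m).sub_of_left hS', ?_⟩
    rw [natDegree_eq_of_degree_eq (degree_sub_eq_left_of_degree_lt hS'), natDegree_X_pow]

theorem jacobiIntegral_monicJacobi_mul {α β : ℝ} (hα : -1 < α) (hβ : -1 < β) {m j : ℕ}
    (hj : j < m) : jacobiIntegral α β (monicJacobi α β m * monicJacobi α β j) = 0 := by
  induction m using Nat.strong_induction_on generalizing j with
  | _ m ih =>
    have hpos := jacobiIntegral_sq_pos hα hβ (monicJacobi_monic_natDegree α β j).1.ne_zero
    rw [monicJacobi_eq α β m, sub_mul, Finset.sum_mul, ← jacobiFunctional_apply hα hβ, map_sub,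
      map_sum, Finset.sum_eq_single (⟨j, hj⟩ : Fin m)]
    · simp only [jacobiFunctional_apply, mul_assoc, jacobiIntegral_C_mul, jacobiInner_eq]
      rw [div_mul_cancel₀ _ hpos.ne', sub_self]
    · intro i _ hi
      rw [mul_assoc, jacobiFunctional_apply, jacobiIntegral_C_mul]
      have hij : (i : ℕ) ≠ j := fun h => hi (Fin.ext h)
      rcases lt_or_gt_of_ne hij with h | h
      · rw [mul_comm (monicJacobi α β i), ih j hj h, mul_zero]
      · rw [ih i i.2 h, mul_zero]
    · simp

theorem jacobiIntegral_monicJacobi_mul_eq_zero {α β : ℝ} (hα : -1 < α) (hβ : -1 < β) {m : ℕ}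
    (N : ℕ) (hN : N ≤ m) (q : ℝ[X]) (hq : q.degree < N) :
    jacobiIntegral α β (monicJacobi α β m * q) = 0 := by
  induction N generalizing q with
  | zero =>
    have : q = 0 := degree_eq_bot.mp (by simpa using hq)
    rw [this, mul_zero, ← jacobiFunctional_apply hα hβ, map_zero]
  | succ N ih =>
    set P := monicJacobi α β N
    obtain ⟨hPm, hPd⟩ := monicJacobi_monic_natDegree α β N
    -- Subtracting the multiple of the monic `P` of degree `N` removes the top coefficient of `q`.
    have hr : (q - C (q.coeff N) * P).degree < N := by
      rw [degree_lt_iff_coeff_zero]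
      intro i hi
      rcases hi.eq_or_lt with rfl | hi
      · have : P.coeff N = 1 := by
          have := hPm.coeff_natDegree
          rwa [hPd] at this
        simp [this]
      · have h1 : q.coeff i = 0 := coeff_eq_zero_of_degree_lt (hq.trans_le (by exact_mod_cast hi))
        have h2 : P.coeff i = 0 := coeff_eq_zero_of_natDegree_lt (by rw [hPd]; exact hi)
        simp [h1, h2]
    have h1 := ih (by omega) _ hr
    have h2 := jacobiIntegral_monicJacobi_mul hα hβ (show N < m by omega)
    have : monicJacobi α β m * q = monicJacobi α β m * (q - C (q.coeff N) * P) +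
        C (q.coeff N) * (monicJacobi α β m * P) := by ring
    rw [this, jacobiIntegral_add hα hβ, h1, jacobiIntegral_C_mul, h2, mul_zero, add_zero]

/-- The monic Jacobi polynomial of degree `m` is the only monic polynomial of degree `m` that is
orthogonal to all polynomials of smaller degree. -/
theorem eq_monicJacobi {α β : ℝ} (hα : -1 < α) (hβ : -1 < β) {g : ℝ[X]} (hg : g.Monic)
    (h : ∀ q : ℝ[X], q.degree < g.degree → jacobiIntegral α β (g * q) = 0) :
    g = monicJacobi α β g.natDegree := by
  obtain ⟨hPm, hPd⟩ := monicJacobi_monic_natDegree α β g.natDegree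
  set P := monicJacobi α β g.natDegree
  have hdeg : g.degree = P.degree := by
    rw [degree_eq_natDegree hg.ne_zero, degree_eq_natDegree hPm.ne_zero, hPd]
  have hd : (g - P).degree < g.degree :=
    degree_sub_lt_left hdeg hg.ne_zero (by rw [hg.leadingCoeff, hPm.leadingCoeff])
  by_contra hne
  have hpos := jacobiIntegral_sq_pos hα hβ (sub_ne_zero.mpr hne)
  have h1 := h _ hd
  have h2 := jacobiIntegral_monicJacobi_mul_eq_zero hα hβ g.natDegree le_rfl (g - P)
    (by rwa [← degree_eq_natDegree hg.ne_zero])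
  rw [sub_mul, ← jacobiFunctional_apply hα hβ, map_sub, jacobiFunctional_apply,
    jacobiFunctional_apply, h1, h2, sub_zero] at hpos
  exact hpos.false

/-! ### The Gegenbauer weight as the image of surface measure -/

/-- The functional of the Gegenbauer weight `(1 - t²)^((n - 3) / 2)`. -/
noncomputable def gegenbauerIntegral (n : ℕ) (p : ℝ[X]) : ℝ :=
  jacobiIntegral (((n : ℝ) - 3) / 2) (((n : ℝ) - 3) / 2) p

theorem neg_one_lt_gegenbauer_exponent {n : ℕ} (hn : 2 ≤ n) : -1 < ((n : ℝ) - 3) / 2 := by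
  have : (2 : ℝ) ≤ n := by exact_mod_cast hn
  linarith

theorem gegenbauerMean_eval (n : ℕ) (p : ℝ[X]) :
    gegenbauerMean n (fun t => p.eval t) = gegenbauerIntegral n p / gegenbauerIntegral n 1 := by
  have h : ∀ q : ℝ[X], ∫ t in (-1 : ℝ)..1, q.eval t * (1 - t ^ 2) ^ (((n : ℝ) - 3) / 2) =
      gegenbauerIntegral n q := fun q => by
    rw [intervalIntegral.integral_of_le (by norm_num), integral_Ioc_eq_integral_Ioo]
    refine setIntegral_congr_fun measurableSet_Ioo fun t ht => ?_
    have h1 : (0 : ℝ) ≤ 1 - t := by linarith [ht.2]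
    have h2 : (0 : ℝ) ≤ 1 + t := by linarith [ht.1]
    simp only [← Real.mul_rpow h1 h2]
    ring_nf
  have h1 := h 1
  simp only [eval_one, one_mul] at h1
  rw [gegenbauerMean, h, h1]

/-- The integrand is the derivative of `q (1 - t²)^(s + 1)`, which vanishes at ±1 because `s + 1 >
0`. Monomials `q` give the moment recursion. -/
theorem integral_deriv_gegenbauer {s : ℝ} (hs : -1 < s) (q : ℝ[X]) :
    jacobiIntegral s s (derivative q * (1 - X ^ 2) - C (2 * (s + 1)) * X * q) = 0 := by
  have hderiv : ∀ t ∈ Set.Ioo (-1 : ℝ) 1,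
      HasDerivAt (fun t => q.eval t * (1 - t ^ 2) ^ (s + 1))
      ((derivative q * (1 - X ^ 2) - C (2 * (s + 1)) * X * q).eval t *
        ((1 - t) ^ s * (1 + t) ^ s)) t := by
    intro t ht
    have h1 : (0 : ℝ) < 1 - t := by linarith [ht.2]
    have h2 : (0 : ℝ) < 1 + t := by linarith [ht.1]
    have h3 : (0 : ℝ) < 1 - t ^ 2 := by nlinarith
    have h4 : HasDerivAt (fun t : ℝ => 1 - t ^ 2) (-(2 * t)) t := by
      simpa using ((hasDerivAt_id t).pow 2).const_sub 1
    have h5 := (q.hasDerivAt t).mul (h4.rpow_const (p := s + 1) (Or.inl h3.ne'))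
    convert! h5 using 1
    rw [← Real.mul_rpow h1.le h2.le, Real.rpow_add_one h3.ne', add_sub_cancel_right,
      show (1 - t) * (1 + t) = 1 - t ^ 2 by ring]
    simp
    ring
  have hint := integrableOn_eval_mul_jacobiWeight hs hs
    (derivative q * (1 - X ^ 2) - C (2 * (s + 1)) * X * q)
  rw [← intervalIntegrable_iff_integrableOn_Ioo_of_le (by norm_num)] at hint
  have key := intervalIntegral.integral_eq_sub_of_hasDerivAt_of_le (by norm_num)
    (q.continuous.continuousOn.mul (ContinuousOn.rpow_const (by fun_prop)
      fun t _ => Or.inr (by linarith))) hderiv hint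
  rw [intervalIntegral.integral_of_le (by norm_num), integral_Ioc_eq_integral_Ioo] at key
  have h0 : s + 1 ≠ 0 := by linarith
  simpa [jacobiIntegral, Real.zero_rpow h0] using key

theorem gegenbauerIntegral_X {n : ℕ} (hn : 2 ≤ n) : gegenbauerIntegral n X = 0 := by
  have hs := neg_one_lt_gegenbauer_exponent hn
  have h := integral_deriv_gegenbauer hs 1
  rw [derivative_one, zero_mul, zero_sub, mul_one, ← jacobiFunctional_apply hs hs, map_neg,
    jacobiFunctional_apply, jacobiIntegral_C_mul, neg_eq_zero, mul_eq_zero] at h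
  exact h.resolve_left (by linarith)

theorem gegenbauerIntegral_X_pow_add_two {n : ℕ} (hn : 2 ≤ n) (m : ℕ) :
    (n + m) * gegenbauerIntegral n (X ^ (m + 2)) = (m + 1) * gegenbauerIntegral n (X ^ m) := by
  have hs := neg_one_lt_gegenbauer_exponent hn
  have h := integral_deriv_gegenbauer hs (X ^ (m + 1))
  have h1 : (derivative (X ^ (m + 1)) * (1 - X ^ 2) -
      C (2 * (((n : ℝ) - 3) / 2 + 1)) * X * X ^ (m + 1) : ℝ[X]) =
      C ((m : ℝ) + 1) * X ^ m - C ((n : ℝ) + m) * X ^ (m + 2) := by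
    rw [derivative_X_pow, show (n : ℝ) + m = 2 * (((n : ℝ) - 3) / 2 + 1) + (m + 1) by ring,
      C_add (a := 2 * (((n : ℝ) - 3) / 2 + 1))]
    simp only [Nat.cast_add, Nat.cast_one, Nat.add_sub_cancel]
    ring
  rw [h1, ← jacobiFunctional_apply hs hs, map_sub, jacobiFunctional_apply, jacobiFunctional_apply,
    jacobiIntegral_C_mul, jacobiIntegral_C_mul] at h
  unfold gegenbauerIntegral
  linarith

theorem gegenbauerIntegral_one_pos {n : ℕ} (hn : 2 ≤ n) : 0 < gegenbauerIntegral n 1 := by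
  have hs := neg_one_lt_gegenbauer_exponent hn
  simpa [gegenbauerIntegral] using jacobiIntegral_sq_pos hs hs (p := 1) one_ne_zero

theorem nontrivial_euclideanSpace {n : ℕ} (hn : 2 ≤ n) : Nontrivial (EuclideanSpace ℝ (Fin n)) := by
  have : Nonempty (Fin n) := ⟨⟨0, by omega⟩⟩
  infer_instance

/-- Equality of normalized moments, cross-multiplied: both sequences vanish at 1 and satisfy the
same two-step recursion. -/
theorem sphereMoment_mul_gegenbauerIntegral {n : ℕ} (hn : 2 ≤ n)
    {x : EuclideanSpace ℝ (Fin n)} (hx : ‖x‖ = 1) (m : ℕ) :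
    sphereMoment x m * gegenbauerIntegral n 1 = gegenbauerIntegral n (X ^ m) * sphereMoment x 0 := by
  have := nontrivial_euclideanSpace hn
  induction m using Nat.twoStepInduction with
  | zero => rw [pow_zero, mul_comm]
  | one => rw [pow_one, gegenbauerIntegral_X hn, sphereMoment_one hx, zero_mul, zero_mul]
  | more m ih _ =>
    have h1 := sphereMoment_add_two hx m
    have h2 := gegenbauerIntegral_X_pow_add_two hn m
    rw [finrank_euclideanSpace_fin] at h1
    have h0 : (n : ℝ) + m ≠ 0 := by positivity
    refine mul_left_cancel₀ h0 ?_
    linear_combination (gegenbauerIntegral n 1) * h1 - sphereMoment x 0 * h2 + (m + 1) * ih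

/-- The push-forward of the surface measure under `y ↦ x · y` is the Gegenbauer measure. -/
theorem average_eval_inner {n : ℕ} (hn : 2 ≤ n) (x : USphere n) (p : ℝ[X]) :
    ⨍ y : USphere n, p.eval (sdot x y) ∂((volume : Measure (EuclideanSpace ℝ (Fin n))).toSphere) =
      gegenbauerMean n fun t => p.eval t := by
  have := nontrivial_euclideanSpace hn
  have hs := neg_one_lt_gegenbauer_exponent hn
  have hx : ‖(x : EuclideanSpace ℝ (Fin n))‖ = 1 := by simp
  set σ := (volume : Measure (EuclideanSpace ℝ (Fin n))).toSphere
  have hM0 : σ.real Set.univ = sphereMoment (x : EuclideanSpace ℝ (Fin n)) 0 := by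
    simp [sphereMoment, σ]
  have hM0ne : σ.real Set.univ ≠ 0 := by
    have : σ ≠ 0 := Measure.toSphere_ne_zero _
    rw [measureReal_def, ENNReal.toReal_ne_zero]
    exact ⟨by simpa using this, measure_ne_top _ _⟩
  have hcont : ∀ m : ℕ, Integrable (fun y : USphere n => sdot x y ^ m) σ := fun m => by
    have hc : Continuous fun y : USphere n => sdot x y ^ m := by
      unfold sdot
      fun_prop
    exact hc.integrable_of_hasCompactSupport (HasCompactSupport.of_compactSpace _)
  have h1 : ∫ y : USphere n, p.eval (sdot x y) ∂σ =
      p.sum fun m a => a * sphereMoment (x : EuclideanSpace ℝ (Fin n)) m := by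
    simp only [eval_eq_sum, Polynomial.sum]
    rw [integral_finsetSum _ fun m _ => (hcont m).const_mul _]
    simp only [integral_const_mul]
    rfl
  have h2 : gegenbauerIntegral n p = p.sum fun m a => a * gegenbauerIntegral n (X ^ m) := by
    conv_lhs => rw [p.as_sum_support_C_mul_X_pow]
    rw [gegenbauerIntegral, ← jacobiFunctional_apply hs hs, map_sum]
    simp only [jacobiFunctional_apply, jacobiIntegral_C_mul]
    rfl
  rw [average_eq, gegenbauerMean_eval, h1, h2, smul_eq_mul, inv_mul_eq_div,
    div_eq_div_iff hM0ne (gegenbauerIntegral_one_pos hn).ne', hM0]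
  simp only [Polynomial.sum, Finset.sum_mul]
  refine Finset.sum_congr rfl fun m _ => ?_
  rw [mul_assoc, mul_assoc, sphereMoment_mul_gegenbauerIntegral hn hx]

/-! ### Designs, inner products and Jacobi zeros -/

/-- A spherical `τ`-design integrates zonal polynomials of degree at most `τ` exactly. -/
theorem IsSphericalDesign.gegenbauerMean_eq {n τ : ℕ} (hn : 2 ≤ n) {K : Finset (USphere n)}
    (hK : IsSphericalDesign τ K) (x : USphere n) {p : ℝ[X]} (hp : p.natDegree ≤ τ) :
    gegenbauerMean n (fun t => p.eval t) = (∑ y ∈ K, p.eval (sdot x y)) / (K.card : ℝ) := by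
  -- `ℓ` is the linear form `y ↦ x · y`; substituting it into `p` does not raise the degree.
  set ℓ : MvPolynomial (Fin n) ℝ :=
    ∑ i, MvPolynomial.C ((x : EuclideanSpace ℝ (Fin n)) i) * MvPolynomial.X i
  have hℓ : ℓ.totalDegree ≤ 1 := MvPolynomial.totalDegree_finsetSum_le fun i _ =>
    (MvPolynomial.totalDegree_mul _ _).trans (by simp)
  have hev : ∀ y : USphere n, MvPolynomial.eval
      (fun i => (y : EuclideanSpace ℝ (Fin n)) i) (aeval ℓ p) = p.eval (sdot x y) := fun y => by
    have h1 : MvPolynomial.eval (fun i => (y : EuclideanSpace ℝ (Fin n)) i) ℓ = sdot x y := by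
      simp [ℓ, sdot, PiLp.inner_apply, mul_comm]
    rw [← h1, aeval_eq_sum_range, eval_eq_sum_range, map_sum]
    simp [MvPolynomial.smul_eq_C_mul]
  have hdeg : (aeval ℓ p).totalDegree ≤ τ := by
    rw [aeval_eq_sum_range]
    refine MvPolynomial.totalDegree_finsetSum_le fun i hi => ?_
    refine (MvPolynomial.totalDegree_smul_le _ _).trans
      ((MvPolynomial.totalDegree_pow _ _).trans ?_)
    have := Finset.mem_range.mp hi
    nlinarith
  have := hK _ hdeg
  simp only [hev] at this
  rw [← this, average_eval_inner hn x p]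

theorem sdot_mem_Icc {n : ℕ} (x y : USphere n) : sdot x y ∈ Set.Icc (-1 : ℝ) 1 := by
  have h := abs_real_inner_le_norm (x : EuclideanSpace ℝ (Fin n)) (y : EuclideanSpace ℝ (Fin n))
  simp only [norm_eq_of_mem_sphere, mul_one] at h
  exact abs_le.mp h

theorem sdot_eq_one_iff {n : ℕ} {x y : USphere n} : sdot x y = 1 ↔ x = y := by
  rw [sdot, inner_eq_one_iff_of_norm_eq_one (by simp) (by simp), Subtype.ext_iff]

theorem sdot_neg_self {n : ℕ} (x : USphere n) : sdot x (-x) = -1 := by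
  simp [sdot, inner_neg_right]

theorem ne_neg_sphere {n : ℕ} (x : USphere n) : x ≠ -x := fun h => by
  have h1 := sdot_neg_self x
  rw [← h, sdot_eq_one_iff.mpr rfl] at h1
  norm_num at h1

/-- The inner products between distinct points of a code, as a finset. -/
noncomputable def innerProductsFinset {n : ℕ} (K : Finset (USphere n)) : Finset ℝ := by
  classical exact K.offDiag.image fun p => sdot p.1 p.2

theorem mem_innerProductsFinset {n : ℕ} {K : Finset (USphere n)} {t : ℝ} :
    t ∈ innerProductsFinset K ↔ ∃ x ∈ K, ∃ y ∈ K, x ≠ y ∧ sdot x y = t := by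
  simp only [innerProductsFinset, Finset.mem_image, Finset.mem_offDiag, Prod.exists]
  constructor
  · rintro ⟨x, y, ⟨hx, hy, hxy⟩, h⟩
    exact ⟨x, hx, y, hy, hxy, h⟩
  · rintro ⟨x, hx, y, hy, hxy, h⟩
    exact ⟨x, y, ⟨hx, hy, hxy⟩, h⟩

theorem card_innerProductsFinset {n : ℕ} (K : Finset (USphere n)) :
    (innerProductsFinset K).card = (innerProducts K).ncard := by
  rw [← Set.ncard_coe_finset]
  congr 1
  ext t
  exact mem_innerProductsFinset

theorem mem_Ico_of_mem_innerProductsFinset {n : ℕ} {K : Finset (USphere n)} {t : ℝ}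
    (ht : t ∈ innerProductsFinset K) : t ∈ Set.Ico (-1 : ℝ) 1 := by
  obtain ⟨x, -, y, -, hxy, rfl⟩ := mem_innerProductsFinset.mp ht
  obtain ⟨h1, h2⟩ := sdot_mem_Icc x y
  exact ⟨h1, h2.lt_of_ne fun h => hxy (sdot_eq_one_iff.mp h)⟩

theorem one_notMem_innerProductsFinset {n : ℕ} (K : Finset (USphere n)) :
    (1 : ℝ) ∉ innerProductsFinset K := fun h =>
  (mem_Ico_of_mem_innerProductsFinset h).2.ne rfl

theorem sdot_mem_insert {n : ℕ} {K : Finset (USphere n)} {x y : USphere n} (hx : x ∈ K)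
    (hy : y ∈ K) : sdot x y ∈ insert 1 (innerProductsFinset K) := by
  by_cases h : x = y
  · exact Finset.mem_insert.mpr (Or.inl (sdot_eq_one_iff.mpr h))
  · exact Finset.mem_insert_of_mem (mem_innerProductsFinset.mpr ⟨x, hx, y, hy, h, rfl⟩)

/-- The constant 1 has mean 1 on the sphere, but its mean over the empty set is `0 / 0 = 0`. -/
theorem IsSphericalDesign.nonempty {n τ : ℕ} (hn : 2 ≤ n) {K : Finset (USphere n)}
    (hK : IsSphericalDesign τ K) : K.Nonempty := by
  by_contra hne
  rw [Finset.not_nonempty_iff_eq_empty] at hne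
  have := nontrivial_euclideanSpace hn
  have : NeZero (volume : Measure (EuclideanSpace ℝ (Fin n))).toSphere :=
    ⟨Measure.toSphere_ne_zero _⟩
  have h := hK 1 (by simp)
  simp [hne, average_const] at h

/-- The Gegenbauer integral annihilates the low degree polynomials vanishing at `1` and at the
inner products of a design. -/
theorem IsSphericalDesign.gegenbauerIntegral_eq_zero {n τ : ℕ} (hn : 2 ≤ n)
    {K : Finset (USphere n)} (hK : IsSphericalDesign τ K) {p : ℝ[X]} (hp : p.natDegree ≤ τ)
    (h1 : p.eval 1 = 0) (hA : ∀ a ∈ innerProductsFinset K, p.eval a = 0) :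
    gegenbauerIntegral n p = 0 := by
  obtain ⟨x, hx⟩ := hK.nonempty hn
  have h := hK.gegenbauerMean_eq hn x hp
  rw [Finset.sum_eq_zero, zero_div, gegenbauerMean_eval, div_eq_zero_iff] at h
  · exact h.resolve_right (gegenbauerIntegral_one_pos hn).ne'
  · intro y hy
    rcases Finset.mem_insert.mp (sdot_mem_insert hx hy) with h | h
    · rw [h, h1]
    · exact hA _ h

/-- If a Jacobi functional annihilates all polynomials of degree less than `2m` vanishing on a set
of at most `m` points, then these points are the zeros of the Jacobi polynomial of degree `m`. -/
theorem nodal_eq_monicJacobi {α β : ℝ} (hα : -1 < α) (hβ : -1 < β) (A : Finset ℝ) (m : ℕ)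
    (hcard : A.card ≤ m) (h : ∀ q : ℝ[X], q.natDegree < 2 * m → (∀ a ∈ A, q.eval a = 0) →
      jacobiIntegral α β q = 0) :
    A.card = m ∧ Lagrange.nodal A id = monicJacobi α β m := by
  set g : ℝ[X] := Lagrange.nodal A id
  have hgm : g.Monic := Lagrange.nodal_monic
  have hgd : g.natDegree = A.card := Lagrange.natDegree_nodal
  have hg0 : ∀ a ∈ A, g.eval a = 0 := fun a ha => Lagrange.eval_nodal_at_node (v := id) ha
  -- With fewer than `m` points, the square of the nodal polynomial would be annihilated, against
  -- positivity.
  have hAm : A.card = m := by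
    by_contra hne
    refine (jacobiIntegral_sq_pos hα hβ hgm.ne_zero).ne' (h _ ?_ fun a ha => ?_)
    · rw [hgm.natDegree_mul hgm, hgd]
      omega
    · simp [hg0 a ha]
  refine ⟨hAm, ?_⟩
  have := eq_monicJacobi hα hβ hgm fun q hq => by
    rcases eq_or_ne q 0 with rfl | hq0
    · rw [mul_zero, ← jacobiFunctional_apply hα hβ, map_zero]
    refine h _ ?_ fun a ha => by simp [hg0 a ha]
    have h1 := natDegree_mul_le (p := g) (q := q)
    have h2 := natDegree_lt_natDegree hq0 hq
    omega
  rwa [hgd, hAm] at this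

/-- Since `1 ∉ A`, the value at 1 is nonzero and the normalization does not collapse to the default
`0⁻¹ = 0`. -/
theorem jacobi_roots_eq {α β : ℝ} {m : ℕ} {A : Finset ℝ} (h1 : (1 : ℝ) ∉ A)
    (h : Lagrange.nodal A id = monicJacobi α β m) (t : ℝ) :
    (jacobi α β m).eval t = 0 ↔ t ∈ A := by
  have hev : ∀ s, (monicJacobi α β m).eval s = 0 ↔ s ∈ A := fun s => by
    rw [← h, Lagrange.eval_nodal, Finset.prod_eq_zero_iff]
    simp [sub_eq_zero]
  rw [jacobi, eval_mul, eval_C, mul_eq_zero, hev,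
    or_iff_right (inv_ne_zero fun h0 => h1 ((hev 1).mp h0))]

theorem mem_pulbNodes_iff {n k ε : ℕ} {A : Finset ℝ} {a b : ℝ}
    (ha : ((1 : ℕ) : ℝ) + ((n : ℝ) - 3) / 2 = a)
    (hb : ((1 - ε : ℕ) : ℝ) + ((n : ℝ) - 3) / 2 = b) (h1 : (1 : ℝ) ∉ A)
    (h : Lagrange.nodal A id = monicJacobi a b (k - 1 + ε)) (t : ℝ) :
    t ∈ pulbNodes n k ε ↔ t = 1 ∨ (t = -1 ∧ 1 - ε ≠ 0) ∨ t ∈ A := by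
  have hz := jacobi_roots_eq h1 h
  have hj : adjacentGegenbauer n 1 (1 - ε) (k - 1 + ε) = jacobi a b (k - 1 + ε) := by
    rw [adjacentGegenbauer, ha, hb]
  have hj0 : jacobi a b (k - 1 + ε) ≠ 0 := fun h0 => h1 ((hz 1).mp (by rw [h0, eval_zero]))
  have hX1 : (X - 1 : ℝ[X]) ≠ 0 := by simpa using X_sub_C_ne_zero (1 : ℝ)
  have hX2 : (X + 1 : ℝ[X]) ≠ 0 := by simpa using X_add_C_ne_zero (1 : ℝ)
  rw [pulbNodes, Multiset.mem_toFinset, pulbPolynomial, hj,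
    mem_roots (mul_ne_zero (mul_ne_zero hX1 (pow_ne_zero _ hX2)) hj0), IsRoot.def]
  simp only [eval_mul, eval_sub, eval_X, eval_one, eval_pow, eval_add, mul_eq_zero, hz,
    pow_eq_zero_iff', sub_eq_zero, add_eq_zero_iff_eq_neg, or_assoc]

/-! ### Attainment of the bound -/

/-- A design whose inner products, together with `1`, form the nodes of the bound, attains it. -/
theorem polarization_of_pulbNodes_eq {n k ε τ : ℕ} (hn : 2 ≤ n) (hkτ : k ≤ τ) {h : ℝ → ℝ}
    {K : Finset (USphere n)} (hK : IsSphericalDesign τ K)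
    (hnodes : pulbNodes n k ε = insert 1 (innerProductsFinset K))
    (hcard : (innerProductsFinset K).card = k) {p : ℝ[X]} (hp : p.natDegree ≤ τ)
    (hpZ : ∀ z ∈ pulbNodes n k ε, p.eval z = h z)
    (hph : ∀ t ∈ Set.Icc (-1 : ℝ) 1, p.eval t ≤ h t) :
    (K.Nonempty ∧ ∀ x ∈ K, ∀ y : USphere n, discretePotential h x K ≤ discretePotential h y K) ∧
    ((pulbNodes n k ε).card = k + 1 ∧
      (∀ a ∈ pulbNodes n k ε, a ∈ Set.Icc (-1 : ℝ) 1 ∧ 0 < pulbWeight n k ε a) ∧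
      ∑ a ∈ pulbNodes n k ε, pulbWeight n k ε a = 1) ∧
    polarization h K = pulbBound n K.card k ε h := by
  classical
  set Z := pulbNodes n k ε
  have hZcard : Z.card = k + 1 := by
    rw [hnodes, Finset.card_insert_of_notMem (one_notMem_innerProductsFinset K), hcard]
  obtain ⟨x₀, hx₀⟩ := hK.nonempty hn
  have hN : (0 : ℝ) < K.card := by exact_mod_cast Finset.card_pos.mpr ⟨x₀, hx₀⟩
  have hmem : ∀ x ∈ K, ∀ y ∈ K, sdot x y ∈ Z := fun x hx y hy => by
    rw [hnodes]
    exact sdot_mem_insert hx hy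
  have hℓ : ∀ a ∈ Z, ∀ z ∈ Z, (Lagrange.basis Z id a).eval z = if z = a then 1 else 0 := by
    intro a ha z hz
    split_ifs with hza
    · rw [hza]
      exact Lagrange.eval_basis_self (v := id) (Set.injOn_id _) ha
    · exact Lagrange.eval_basis_of_ne (v := id) (Ne.symm hza) hz
  -- The Lagrange basis has degree `k ≤ τ`, so the design integrates it exactly; on inner products
  -- from `x` it is the indicator of `a`.
  have hw : ∀ x ∈ K, ∀ a ∈ Z, pulbWeight n k ε a =
      (∑ y ∈ K, if sdot x y = a then (1 : ℝ) else 0) / K.card := fun x hx a ha => by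
    rw [pulbWeight, hK.gegenbauerMean_eq hn x]
    · congr 1
      exact Finset.sum_congr rfl fun y hy => hℓ a ha _ (hmem x hx y hy)
    · rw [Lagrange.natDegree_basis (Set.injOn_id _) ha, hZcard]
      omega
  -- Kept general in `g`: `g = 1` gives the total weight, `g = h` the bound.
  have hbound : ∀ g : ℝ → ℝ, ∀ x ∈ K,
      (K.card : ℝ) * ∑ a ∈ Z, pulbWeight n k ε a * g a = discretePotential g x K := by
    intro g x hx
    rw [Finset.sum_congr rfl fun a ha => by rw [hw x hx a ha], Finset.mul_sum, discretePotential,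
      Finset.sum_congr rfl fun a _ => show (K.card : ℝ) *
        ((∑ y ∈ K, if sdot x y = a then (1 : ℝ) else 0) / K.card * g a) =
        ∑ y ∈ K, if sdot x y = a then g a else 0 by
          rw [div_mul_eq_mul_div, mul_div_cancel₀ _ hN.ne', Finset.sum_mul]
          simp only [ite_mul, one_mul, zero_mul], Finset.sum_comm]
    exact Finset.sum_congr rfl fun y hy => by rw [Finset.sum_ite_eq, if_pos (hmem x hx y hy)]
  have hmin : ∀ x ∈ K, ∀ y : USphere n, discretePotential h x K ≤ discretePotential h y K := by
    intro x hx y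
    have h1 : ∑ z ∈ K, p.eval (sdot x z) = ∑ z ∈ K, p.eval (sdot y z) :=
      (div_left_inj' hN.ne').mp
        ((hK.gegenbauerMean_eq hn x hp).symm.trans (hK.gegenbauerMean_eq hn y hp))
    calc discretePotential h x K = ∑ z ∈ K, p.eval (sdot x z) :=
          Finset.sum_congr rfl fun z hz => (hpZ _ (hmem x hx z hz)).symm
      _ = ∑ z ∈ K, p.eval (sdot y z) := h1
      _ ≤ discretePotential h y K := Finset.sum_le_sum fun z _ => hph _ (sdot_mem_Icc y z)
  refine ⟨⟨⟨x₀, hx₀⟩, hmin⟩, ⟨hZcard, fun a ha => ?_, ?_⟩, ?_⟩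
  · obtain ⟨x, hx, y, hy, hxy⟩ : ∃ x ∈ K, ∃ y ∈ K, sdot x y = a := by
      rw [hnodes] at ha
      rcases Finset.mem_insert.mp ha with rfl | ha
      · exact ⟨x₀, hx₀, x₀, hx₀, sdot_eq_one_iff.mpr rfl⟩
      · obtain ⟨x, hx, y, hy, -, hxy⟩ := mem_innerProductsFinset.mp ha
        exact ⟨x, hx, y, hy, hxy⟩
    refine ⟨hxy ▸ sdot_mem_Icc x y, ?_⟩
    rw [hw x hx a ha]
    refine div_pos (Finset.sum_pos' (fun z _ => ?_) ⟨y, hy, ?_⟩) hN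
    · split_ifs <;> norm_num
    · rw [if_pos hxy]
      exact one_pos
  · have h1 := hbound (fun _ => 1) x₀ hx₀
    simp only [mul_one, discretePotential, Finset.sum_const, nsmul_eq_mul] at h1
    exact mul_left_cancel₀ hN.ne' (h1.trans (mul_one _).symm)
  · have : Nonempty (USphere n) := ⟨x₀⟩
    rw [pulbBound, hbound h x₀ hx₀]
    exact le_antisymm (ciInf_le ⟨_, Set.forall_mem_range.mpr (hmin x₀ hx₀)⟩ x₀)
      (le_ciInf (hmin x₀ hx₀))

/-- The zeros of the Jacobi polynomial of a sharp code of even strength. -/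
theorem IsSharp.even_nodes {n k : ℕ} (hn : 2 ≤ n) (hk : 1 ≤ k) {K : Finset (USphere n)}
    (hK : IsSharp (2 * k) K) :
    (innerProductsFinset K).card = k ∧ (-1 : ℝ) ∉ innerProductsFinset K ∧
      pulbNodes n k 1 = insert 1 (innerProductsFinset K) := by
  obtain ⟨hdes, hcard⟩ := hK
  rw [← card_innerProductsFinset] at hcard
  set A := innerProductsFinset K with hA
  set s := ((n : ℝ) - 3) / 2 with hs_def
  have hs : -1 < s := neg_one_lt_gegenbauer_exponent hn
  -- `(1 - X) * q` has degree at most `2k` and vanishes at 1 and on `A`, so the design property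
  -- annihilates it.
  obtain ⟨hAk, hnod⟩ := nodal_eq_monicJacobi (α := s + 1) (β := s) (by linarith) hs A k (by omega)
    fun q hq hqA => by
      rw [jacobiIntegral_add_one_left]
      refine hdes.gegenbauerIntegral_eq_zero hn ?_ (by simp) fun a ha => by simp [hqA a ha]
      have h1 := natDegree_mul_le (p := (1 - X : ℝ[X])) (q := q)
      have h2 : (1 - X : ℝ[X]).natDegree ≤ 1 := by compute_degree
      omega
  refine ⟨hAk, fun hneg => ?_, ?_⟩
  -- If `-1 ∈ A`, then `(1 + X)(1 - X) g²` has degree `2k` and vanishes on all inner products, yet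
  -- its integral is positive.
  · set g : ℝ[X] := Lagrange.nodal (A.erase (-1)) id
    have hgm : g.Monic := Lagrange.nodal_monic
    have hgd : g.natDegree = k - 1 := by
      rw [Lagrange.natDegree_nodal, Finset.card_erase_of_mem hneg, hAk]
    have hpos := jacobiIntegral_sq_pos (α := s + 1) (β := s + 1) (by linarith) (by linarith)
      hgm.ne_zero
    rw [jacobiIntegral_add_one_left, jacobiIntegral_add_one_right] at hpos
    refine hpos.ne' (hdes.gegenbauerIntegral_eq_zero hn ?_ (by simp) fun a ha => ?_)
    · have h1 := natDegree_mul_le (p := (1 + X : ℝ[X])) (q := (1 - X) * (g * g))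
      have h2 := natDegree_mul_le (p := (1 - X : ℝ[X])) (q := g * g)
      have h3 : (1 - X : ℝ[X]).natDegree ≤ 1 := by compute_degree
      have h4 : (1 + X : ℝ[X]).natDegree ≤ 1 := by compute_degree
      rw [hgm.natDegree_mul hgm, hgd] at h2
      omega
    · by_cases h : a = -1
      · simp [h]
      · have : g.eval a = 0 :=
          Lagrange.eval_nodal_at_node (v := id) (Finset.mem_erase.mpr ⟨h, ha⟩)
        simp [this]
  · ext t
    rw [mem_pulbNodes_iff (a := s + 1) (b := s) (A := A) (by push_cast; ring) (by simp [hs_def])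
      (one_notMem_innerProductsFinset K) (by rw [hnod, Nat.sub_add_cancel hk])]
    simp

/-- The zeros of the Jacobi polynomial of an antipodal sharp code of odd strength. -/
theorem IsAntipodalSharp.odd_nodes {n k : ℕ} (hn : 2 ≤ n) (hk : 1 ≤ k) {K : Finset (USphere n)}
    (hK : IsAntipodalSharp (2 * k - 1) K) :
    (innerProductsFinset K).card = k ∧ (-1 : ℝ) ∈ innerProductsFinset K ∧
      pulbNodes n k 0 = insert 1 (innerProductsFinset K) := by
  obtain ⟨⟨hdes, hcard⟩, hanti⟩ := hK
  rw [← card_innerProductsFinset] at hcard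
  set A := innerProductsFinset K with hA
  set s := ((n : ℝ) - 3) / 2 with hs_def
  have hs : -1 < s := neg_one_lt_gegenbauer_exponent hn
  obtain ⟨x, hx⟩ := hdes.nonempty hn
  have hneg : (-1 : ℝ) ∈ A :=
    mem_innerProductsFinset.mpr ⟨x, hx, -x, hanti x hx, ne_neg_sphere x, sdot_neg_self x⟩
  have hec := Finset.card_erase_add_one hneg
  -- Antipodality supplies `-1 ∈ A`, so both endpoint factors move into the weight; `(1 + X)(1 - X)
  -- q` has degree at most `2k - 1`.
  obtain ⟨hAk, hnod⟩ := nodal_eq_monicJacobi (α := s + 1) (β := s + 1) (by linarith) (by linarith)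
    (A.erase (-1)) (k - 1) (by omega) fun q hq hqA => by
      rw [jacobiIntegral_add_one_left, jacobiIntegral_add_one_right]
      refine hdes.gegenbauerIntegral_eq_zero hn ?_ (by simp) fun a ha => ?_
      · have h1 := natDegree_mul_le (p := (1 + X : ℝ[X])) (q := (1 - X) * q)
        have h2 := natDegree_mul_le (p := (1 - X : ℝ[X])) (q := q)
        have h3 : (1 - X : ℝ[X]).natDegree ≤ 1 := by compute_degree
        have h4 : (1 + X : ℝ[X]).natDegree ≤ 1 := by compute_degree
        omega
      · by_cases h : a = -1
        · simp [h]
        · simp [hqA a (Finset.mem_erase.mpr ⟨h, ha⟩)]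
  refine ⟨by omega, hneg, ?_⟩
  ext t
  rw [mem_pulbNodes_iff (a := s + 1) (b := s + 1) (A := A.erase (-1)) (by push_cast; ring)
    (by push_cast; ring)
    (fun h => one_notMem_innerProductsFinset K (Finset.mem_of_mem_erase h)) hnod]
  simp only [Finset.mem_insert, Finset.mem_erase]
  by_cases h : t = -1 <;> simp [h, hneg]

theorem mainTheorem5 (n : ℕ) (hn : 2 ≤ n) (k ε τ : ℕ) (hk : 1 ≤ k) (hε : ε = 0 ∨ ε = 1)
    (hτ : τ = 2 * k - 1 + ε) (h : ℝ → ℝ) (hcont : ContinuousOn h (Set.Icc (-1) 1))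
    (hdiff : ∀ i ≤ τ, ∀ t ∈ Set.Ioo (-1 : ℝ) 1, DifferentiableAt ℝ (iteratedDeriv i h) t)
    (hneg : ∀ t ∈ Set.Ioo (-1 : ℝ) 1, iteratedDeriv (τ + 1) h t ≤ 0)
    (C : Finset (USphere n)) (hC : IsStronglySharp τ C ∨ IsAntipodalSharp τ C) :
    -- the minimum of the potential over the sphere is attained at the points of the code
    (C.Nonempty ∧ ∀ x ∈ C, ∀ y : USphere n, discretePotential h x C ≤ discretePotential h y C) ∧
    -- the nodes and weights of the bound form a quadrature on `[-1, 1]`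
    ((pulbNodes n k ε).card = k + 1 ∧
      (∀ a ∈ pulbNodes n k ε, a ∈ Set.Icc (-1 : ℝ) 1 ∧ 0 < pulbWeight n k ε a) ∧
      ∑ a ∈ pulbNodes n k ε, pulbWeight n k ε a = 1) ∧
    -- the code attains the bound
    polarization h C = pulbBound n C.card k ε h := by
  classical
  have hsharp : IsSharp τ C := hC.elim (fun h => h.1) fun h => h.1
  set A := innerProductsFinset C
  -- `D` is the set of double nodes: all of `A` when `ε = 1`, and `A` without `-1` when `ε = 0`. It
  -- must avoid `-1`, where `h` need not be differentiable.
  suffices H : ∃ D ⊆ A, A.card = k ∧ pulbNodes n k ε = insert 1 A ∧ A.card + D.card = τ ∧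
      (-1 : ℝ) ∉ D ∧
      ∀ t ∈ Set.Icc (-1 : ℝ) 1, (t - 1) * (∏ z ∈ A, (t - z)) * ∏ d ∈ D, (t - d) ≤ 0 by
    obtain ⟨D, hDA, hAk, hnodes, hDc, hD1, hsign⟩ := H
    have h1A : (1 : ℝ) ∉ A := one_notMem_innerProductsFinset C
    have hZc : (insert 1 A).card + D.card = τ + 1 := by
      rw [Finset.card_insert_of_notMem h1A]
      omega
    obtain ⟨p, hp, hpZ, hph⟩ := exists_hermite_le (a := -1) (b := 1) (insert 1 A) D
      (hDA.trans (Finset.subset_insert _ _)) (Finset.insert_nonempty _ _)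
      (fun z hz => by
        rcases Finset.mem_insert.mp hz with rfl | hz
        · norm_num
        · exact Set.Ico_subset_Icc_self (mem_Ico_of_mem_innerProductsFinset hz))
      (fun d hd => by
        have h1 := mem_Ico_of_mem_innerProductsFinset (hDA hd)
        exact ⟨h1.1.lt_of_ne fun h => hD1 (h ▸ hd), h1.2⟩)
      (fun i => iteratedDeriv i h) (by simpa using hcont)
      (fun i hi t ht => by
        rw [iteratedDeriv_succ]
        exact (hdiff i (by omega) t ht).hasDerivAt)
      (fun t ht => by simpa only [hZc] using hneg t ht)
      (fun t ht => by
        rw [Finset.prod_insert h1A]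
        exact hsign t ht)
    simp only [iteratedDeriv_zero] at hpZ hph
    exact polarization_of_pulbNodes_eq hn (by omega) hsharp.1 hnodes hAk (by omega)
      (fun z hz => hpZ z (hnodes ▸ hz)) hph
  rcases hε with rfl | rfl
  · have hanti : IsAntipodalSharp (2 * k - 1) C := by
      rcases hC with hC | hC
      · obtain ⟨r, hr⟩ := hC.2
        omega
      · rwa [hτ] at hC
    obtain ⟨hAk, hmem, hnodes⟩ := hanti.odd_nodes hn hk
    have hec : (A.erase (-1)).card + 1 = A.card := Finset.card_erase_add_one hmem
    replace hAk : A.card = k := hAk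
    refine ⟨A.erase (-1), Finset.erase_subset _ _, hAk, hnodes, by omega, by simp,
      fun t ht => ?_⟩
    rw [← Finset.mul_prod_erase A (fun z => t - z) hmem]
    have h1 : (t - 1) * (t - -1) ≤ 0 :=
      mul_nonpos_of_nonpos_of_nonneg (by linarith [ht.2]) (by linarith [ht.1])
    have h2 := mul_nonpos_of_nonpos_of_nonneg h1 (mul_self_nonneg (∏ z ∈ A.erase (-1), (t - z)))
    linarith
  · have hτ' : τ = 2 * k := by omega
    obtain ⟨hAk, hmem, hnodes⟩ := IsSharp.even_nodes hn hk (hτ' ▸ hsharp)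
    replace hAk : A.card = k := hAk
    refine ⟨A, subset_rfl, hAk, hnodes, by omega, hmem, fun t ht => ?_⟩
    rw [mul_assoc]
    exact mul_nonpos_of_nonpos_of_nonneg (by linarith [ht.2]) (mul_self_nonneg _)
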